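/- Let $\mathcal D(\mathbb C^d\otimes\mathbb C^d)$ be the set of density operators (positive semidefinite, trace one) on $\mathbb C^d\otimes\mathbb C^d$. The Schmidt rank $\mathrm{SR}(\psi)$ of a unit vector $\psi\in\mathbb C^d\otimes\mathbb C^d$ is the number of nonzero coefficients in its Schmidt decomposition. The Schmidt number of $\rho\in\mathcal D(\mathbb C^d\otimes\mathbb C^d)$ is $$\mathrm{SN}(\rho)=\min_{\{p_k,\psi_k\}}\ \max_k\ \mathrm{SR}(\psi_k),$$ where the minimum is over all finite ensembles of unit vectors $\psi_k\in\mathbb C^d\otimes\mathbb C^d$ and probabilities $p_k\ge 0$, $\sum_k p_k=1$, with $\rho=\sum_k p_k|\psi_k\rangle\langle\psi_k|$. Let $r\text{-}\mathrm{ABSN}$ be the set of all $\rho\in\mathcal D(\mathbb C^d\otimes\mathbb C^d)$ such that $\mathrm{SN}(U\rho U^\dagger)\le r$ for every unitary operator $U$ on $\mathbb C^d\otimes\mathbb C^d$. Theorem. If a state $\rho\in\mathcal D(\mathbb C^3\otimes\mathbb C^3)$ satisfies $\operatorname{Tr}(\rho^2)\le\frac18$, then $\rho\in 2\text{-}\mathrm{ABSN}$;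 that is, $\mathrm{SN}(U\rho U^\dagger)\le 2$ for every unitary $U$ on $\mathbb C^3\otimes\mathbb C^3$. -/

import Mathlib

open scoped ComplexOrder

/-- Vectors of the bipartite space `ℂ^d ⊗ ℂ^d` in the product basis, with the Euclidean norm. -/
abbrev BipartiteVec (d : ℕ) : Type := EuclideanSpace ℂ (Fin d × Fin d)

/-- Operators on `ℂ^d ⊗ ℂ^d` as matrices in the product basis. -/
abbrev BipartiteOp (d : ℕ) : Type := Matrix (Fin d × Fin d) (Fin d × Fin d) ℂ

/-- The set `D(ℂ^d ⊗ ℂ^d)` of density operators. -/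
def densityOperators (d : ℕ) : Set (BipartiteOp d) :=
  {ρ | ρ.PosSemidef ∧ ρ.trace = 1}

/-- The matrix of coefficients of `ψ = ∑ i j, ψ (i, j) e_i ⊗ e_j`. -/
def coeffMatrix {d : ℕ} (ψ : BipartiteVec d) : Matrix (Fin d) (Fin d) ℂ :=
  Matrix.of fun i j => ψ (i, j)

/-- The Schmidt rank of a vector, as the rank of its coefficient matrix; this is the number of
nonzero coefficients in any Schmidt decomposition, see `schmidtRank_eq_card`. -/
noncomputable def schmidtRank {d : ℕ} (ψ : BipartiteVec d) : ℕ :=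
  (coeffMatrix ψ).rank

/-- For any Schmidt decomposition `ψ = ∑ l, √(c l) a_l ⊗ b_l` with orthonormal families `a`, `b`
and coefficients `c l ≥ 0`, the Schmidt rank is the number of nonzero coefficients. -/
theorem schmidtRank_eq_card {d : ℕ} {ι : Type*} [Fintype ι] (ψ : BipartiteVec d) (c : ι → ℝ)
    (a b : ι → EuclideanSpace ℂ (Fin d)) (hc : ∀ l, 0 ≤ c l)
    (ha : Orthonormal ℂ a) (hb : Orthonormal ℂ b)
    (hψ : ∀ i j, ψ (i, j) = ∑ l, (Real.sqrt (c l) : ℂ) * (a l i * b l j)) :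
    schmidtRank ψ = Nat.card {l // c l ≠ 0} := by
  classical
  let A : Matrix ι (Fin d) ℂ := Matrix.of fun l i => a l i
  let B : Matrix ι (Fin d) ℂ := Matrix.of fun l i => b l i
  let D : Matrix ι ι ℂ := Matrix.diagonal fun l => (Real.sqrt (c l) : ℂ)
  have hM : coeffMatrix ψ = A.transpose * D * B := by
    ext i j
    rw [Matrix.mul_apply]
    simp only [coeffMatrix, Matrix.of_apply, hψ, D, Matrix.mul_diagonal,
      Matrix.transpose_apply, A, B]
    exact Finset.sum_congr rfl fun l _ => by ring
  have gram : ∀ (e : ι → EuclideanSpace ℂ (Fin d)), Orthonormal ℂ e →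
      (Matrix.of fun l i => e l i : Matrix ι (Fin d) ℂ) *
        (Matrix.of fun l i => e l i : Matrix ι (Fin d) ℂ).conjTranspose = 1 := by
    intro e he
    ext k l
    have h := orthonormal_iff_ite.mp he l k
    simp only [PiLp.inner_apply, RCLike.inner_apply] at h
    simp only [Matrix.mul_apply, Matrix.conjTranspose_apply, Matrix.of_apply, Matrix.one_apply]
    rw [eq_comm (a := k)]
    exact h
  have hA : A * A.conjTranspose = 1 := gram a ha
  have hB : B * B.conjTranspose = 1 := gram b hb
  have hA' : A.conjTranspose.transpose * A.transpose = 1 := by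
    rw [← Matrix.transpose_mul, hA, Matrix.transpose_one]
  have hD : D = A.conjTranspose.transpose * coeffMatrix ψ * B.conjTranspose := by
    calc D = (A.conjTranspose.transpose * A.transpose) * D * (B * B.conjTranspose) := by
          rw [hA', hB, Matrix.one_mul, Matrix.mul_one]
      _ = _ := by rw [hM]; simp only [Matrix.mul_assoc]
  have h1 : (coeffMatrix ψ).rank ≤ D.rank := by
    rw [hM]
    exact (Matrix.rank_mul_le_left _ _).trans (Matrix.rank_mul_le_right _ _)
  have h2 : D.rank ≤ (coeffMatrix ψ).rank := by
    conv_lhs => rw [hD]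
    exact (Matrix.rank_mul_le_left _ _).trans (Matrix.rank_mul_le_right _ _)
  have h3 : D.rank = Nat.card {l // c l ≠ 0} := by
    rw [Matrix.rank_diagonal, ← Nat.card_eq_fintype_card]
    refine Nat.card_congr (Equiv.subtypeEquivRight fun l => ?_)
    rw [Ne, Complex.ofReal_eq_zero, Real.sqrt_eq_zero (hc l)]
  exact (le_antisymm h1 h2).trans h3

/-- A finite ensemble of pure states (unit vectors) of `ℂ^d ⊗ ℂ^d` with their probabilities. -/
structure PureEnsemble (d : ℕ) where
  /-- the number of members -/
  size : ℕ
  /-- the probabilities -/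
  prob : Fin size → ℝ
  /-- the pure states -/
  vec : Fin size → BipartiteVec d
  prob_nonneg : ∀ k, 0 ≤ prob k
  sum_prob : ∑ k, prob k = 1
  norm_vec : ∀ k, ‖vec k‖ = 1

/-- The mixture `∑ k, p_k |ψ_k⟩⟨ψ_k|` of an ensemble. -/
noncomputable def PureEnsemble.mixture {d : ℕ} (E : PureEnsemble d) : BipartiteOp d :=
  ∑ k, (E.prob k : ℂ) • Matrix.vecMulVec (fun x => E.vec k x) (fun x => star (E.vec k x))

/-- The Schmidt number: the minimum, over all pure-state ensembles with mixture `ρ`, of the largest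
Schmidt rank in the ensemble. It takes values in `ℕ∞`, so that it is `⊤` (and not `0`) for a matrix
without such an ensemble. -/
noncomputable def schmidtNumber {d : ℕ} (ρ : BipartiteOp d) : ℕ∞ :=
  ⨅ (E : PureEnsemble d) (_ : E.mixture = ρ), ⨆ k, (schmidtRank (E.vec k) : ℕ∞)

/-- The set `r`-ABSN of states on `ℂ^d ⊗ ℂ^d` whose Schmidt number is at most `r` after every
global unitary. -/
def absoluteSchmidt (r d : ℕ) : Set (BipartiteOp d) :=
  {ρ | ρ ∈ densityOperators d ∧
    ∀ U ∈ Matrix.unitaryGroup (Fin d × Fin d) ℂ, schmidtNumber (U * ρ * star U) ≤ (r : ℕ∞)}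

/-! Purity is unitarily invariant, so it suffices to treat each `U * ρ * star U` in the fixed
product basis, with N = 9 and N - 1 = 8. Such a state turns out to be a mixture of unit vectors
supported on two product basis vectors, which have Schmidt rank at most 2.

If it were not, a real functional f would strictly separate it from the compact hull of these
projectors: f < u there. Put s_x = √(u - f(E_xx)). Testing f on vectors a e_x + b e_y bounds its
off-diagonal part by 2|z| s_x s_y, and summing over entries gives f(ρ) ≤ u - sᵀMs, where M is the
comparison matrix with diagonal ρ_xx and off-diagonal -|ρ_xy|. M has the trace and Frobenius norm of
ρ, and trace 1 with squared norm at most 1/(N - 1) forces sᵀMs ≥ 0, contradicting f(ρ) > u. -/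

theorem sum_eq_sum_of_embedding {ι κ F : Type*} [Fintype ι] [Fintype κ] [AddCommMonoid F]
    (e : ι ↪ κ) (g : ι → F) (h : κ → F) (hg : ∀ i, h (e i) = g i)
    (h0 : ∀ j, j ∉ Set.range e → h j = 0) : ∑ j, h j = ∑ i, g i := by
  refine (Finset.sum_of_injOn e e.injective.injOn (by simp) (fun j _ hj => h0 j ?_)
    (fun i _ => (hg i).symm)).symm
  simpa using hj

/-- In a finite-dimensional space the convex hull of a compact set is compact. -/
theorem IsCompact.convexHull_of_finiteDimensional {E : Type*} [AddCommGroup E] [Module ℝ E]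
    [TopologicalSpace E] [ContinuousAdd E] [ContinuousSMul ℝ E] [FiniteDimensional ℝ E]
    {s : Set E} (hs : IsCompact s) : IsCompact (convexHull ℝ s) := by
  classical
  obtain rfl | ⟨z₀, hz₀⟩ := s.eq_empty_or_nonempty
  · simp
  -- Carathéodory: this many points suffice, so the hull is a continuous image of simplex × sᴺ.
  -- Shorter combinations are padded with weight 0 at `z₀`.
  let N := Module.finrank ℝ E + 1
  have hK : IsCompact (stdSimplex ℝ (Fin N) ×ˢ Set.univ.pi fun _ : Fin N => s) :=
    (isCompact_stdSimplex ℝ (Fin N)).prod (isCompact_univ_pi fun _ => hs)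
  have hcont : Continuous fun p : (Fin N → ℝ) × (Fin N → E) => ∑ i, p.1 i • p.2 i := by
    fun_prop
  convert hK.image hcont using 1
  ext x
  constructor
  · intro hx
    obtain ⟨ι, _, z, w, hz, hind, hw, hw1, hx⟩ := eq_pos_convex_span_of_mem_convexHull hx
    have hcard : Fintype.card ι ≤ Fintype.card (Fin N) := by
      rw [Fintype.card_fin]
      exact hind.card_le_finrank_succ.trans
        (Nat.succ_le_succ (Submodule.finrank_le _))
    obtain ⟨e⟩ := Function.Embedding.nonempty_of_card_le hcard
    refine ⟨(Function.extend e w 0, Function.extend e z fun _ => z₀), ⟨⟨?_, ?_⟩, ?_⟩, ?_⟩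
    · intro j
      by_cases hj : ∃ i, e i = j
      · obtain ⟨i, rfl⟩ := hj
        simpa [e.injective.extend_apply] using (hw i).le
      · simp [Function.extend_apply' _ _ _ hj]
    · rw [← hw1]
      refine sum_eq_sum_of_embedding e w _ (fun i => e.injective.extend_apply _ _ _) fun j hj => ?_
      exact Function.extend_apply' w (0 : Fin N → ℝ) j hj
    · intro j _
      by_cases hj : ∃ i, e i = j
      · obtain ⟨i, rfl⟩ := hj
        simpa [e.injective.extend_apply] using hz ⟨i, rfl⟩
      · simpa [Function.extend_apply' _ _ _ hj] using hz₀
    · rw [← hx]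
      refine sum_eq_sum_of_embedding e _ _ (fun i => ?_) fun j hj => ?_
      · simp [e.injective.extend_apply]
      · have h0 : Function.extend e w (0 : Fin N → ℝ) j = 0 := Function.extend_apply' w (0 : Fin N → ℝ) j hj
        simp [h0]
  · rintro ⟨⟨w, z⟩, ⟨⟨hw, hw1⟩, hz⟩, rfl⟩
    exact mem_convexHull_of_exists_fintype w z hw hw1 (fun i => hz i (Set.mem_univ i)) rfl

/-! ### Positivity from small Frobenius norm -/

/-- A real matrix with trace one and small Frobenius norm has nonnegative quadratic form. -/
theorem sum_mul_mul_nonneg_of_sum_sq_le {n : Type*} [Fintype n] [DecidableEq n]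
    (hn : 1 < Fintype.card n) (M : n → n → ℝ) (htr : ∑ x, M x x = 1)
    (hM : ((Fintype.card n : ℝ) - 1) * ∑ x, ∑ y, M x y ^ 2 ≤ 1) (s : n → ℝ) :
    0 ≤ ∑ x, ∑ y, M x y * (s x * s y) := by
  set N : ℝ := (Fintype.card n : ℝ) with hN
  have hN1 : 1 < N := by rw [hN]; exact_mod_cast hn
  have hN0 : N ≠ 0 := by positivity
  set S := ∑ x, s x ^ 2 with hS
  set A := ∑ x, ∑ y, M x y * (s x * s y) with hA
  set F := ∑ x, ∑ y, M x y ^ 2 with hF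
  have hS0 : 0 ≤ S := Finset.sum_nonneg fun x _ => sq_nonneg _
  let δ : n → n → ℝ := fun x y => if x = y then 1 else 0
  -- Cauchy–Schwarz for the traceless parts of M and of s sᵀ.
  have hcs := Finset.sum_mul_sq_le_sq_mul_sq (Finset.univ : Finset (n × n))
    (fun p => M p.1 p.2 - δ p.1 p.2 / N) (fun p => s p.1 * s p.2 - S / N * δ p.1 p.2)
  simp only [Fintype.sum_prod_type] at hcs
  have hδδ : ∀ x y, δ x y * δ x y = δ x y := by intro x y; simp [δ]
  have hδ : ∀ g : n → n → ℝ, ∑ x, ∑ y, g x y * δ x y = ∑ x, g x x := by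
    intro g; simp [δ]
  have hδ1 : ∑ x, ∑ y, δ x y = N := by simp [δ, hN]
  have h1 : ∑ x, ∑ y, (M x y - δ x y / N) * (s x * s y - S / N * δ x y) = A - S / N := by
    have e : ∀ x y, (M x y - δ x y / N) * (s x * s y - S / N * δ x y)
        = M x y * (s x * s y) - S / N * (M x y * δ x y) - (1 / N) * ((s x * s y) * δ x y)
          + S / N ^ 2 * δ x y := by
      intro x y
      linear_combination (S / N ^ 2) * hδδ x y
    simp only [e, Finset.sum_add_distrib, Finset.sum_sub_distrib, ← Finset.mul_sum]
    rw [hδ, hδ, hδ1, htr]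
    simp only [← pow_two, ← hS, ← hA]
    field_simp
    ring
  have h2 : ∑ x, ∑ y, (M x y - δ x y / N) ^ 2 = F - 1 / N := by
    have e : ∀ x y, (M x y - δ x y / N) ^ 2
        = M x y ^ 2 - 2 / N * (M x y * δ x y) + 1 / N ^ 2 * δ x y := by
      intro x y
      linear_combination (1 / N ^ 2) * hδδ x y
    simp only [e, Finset.sum_add_distrib, Finset.sum_sub_distrib, ← Finset.mul_sum]
    rw [hδ, hδ1, htr, ← hF]
    field_simp
    ring
  have h3 : ∑ x, ∑ y, (s x * s y - S / N * δ x y) ^ 2 = S ^ 2 * (1 - 1 / N) := by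
    have e : ∀ x y, (s x * s y - S / N * δ x y) ^ 2
        = s x ^ 2 * s y ^ 2 - 2 * (S / N) * ((s x * s y) * δ x y) + S ^ 2 / N ^ 2 * δ x y := by
      intro x y
      linear_combination (S ^ 2 / N ^ 2) * hδδ x y
    simp only [e, Finset.sum_add_distrib, Finset.sum_sub_distrib, ← Finset.mul_sum]
    rw [hδ, hδ1]
    simp only [← Finset.sum_mul, ← pow_two, ← hS]
    field_simp
    ring
  rw [h1, h2, h3] at hcs
  -- The threshold is exactly what gives (1/(N-1) - 1/N)(1 - 1/N) = 1/N², so the deviation of A from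
  -- S/N is at most S/N.
  have hF1 : F ≤ 1 / (N - 1) := by
    rw [le_div_iff₀ (by linarith)]
    linarith
  have h4 : (F - 1 / N) * (S ^ 2 * (1 - 1 / N)) ≤ (S / N) ^ 2 := by
    have hfac : 0 ≤ S ^ 2 * (1 - 1 / N) := by
      have : 1 / N ≤ 1 := by rw [div_le_one (by linarith)]; exact hN1.le
      exact mul_nonneg (sq_nonneg _) (by linarith)
    calc (F - 1 / N) * (S ^ 2 * (1 - 1 / N))
        ≤ (1 / (N - 1) - 1 / N) * (S ^ 2 * (1 - 1 / N)) :=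
          mul_le_mul_of_nonneg_right (by linarith) hfac
      _ = (S / N) ^ 2 := by
          have : N - 1 ≠ 0 := by linarith
          field_simp
          ring
  have h5 := abs_le_of_sq_le_sq (hcs.trans h4) (by positivity)
  linarith [(abs_le.mp h5).1]

/-! ### Two-supported projectors and functionals bounded on them -/

/-- The rank-one projectors onto unit vectors supported on at most two basis vectors. -/
def twoSupportedProjectors (n : Type*) [Fintype n] : Set (Matrix n n ℂ) :=
  {X | ∃ x y, ∃ ψ : EuclideanSpace ℂ n, ‖ψ‖ = 1 ∧ (∀ z, z ≠ x → z ≠ y → ψ z = 0) ∧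
    Matrix.vecMulVec (fun z => ψ z) (fun z => star (ψ z)) = X}

theorem isCompact_twoSupportedProjectors (n : Type*) [Fintype n] :
    IsCompact (twoSupportedProjectors n) := by
  have h : twoSupportedProjectors n = ⋃ x, ⋃ y,
      (fun ψ : EuclideanSpace ℂ n => Matrix.vecMulVec (fun z => ψ z) (fun z => star (ψ z))) ''
        (Metric.sphere 0 1 ∩ ⋂ z, ⋂ (_ : z ≠ x), ⋂ (_ : z ≠ y), {ψ | ψ z = 0}) := by
    ext X
    simp [twoSupportedProjectors, and_assoc]
  rw [h]
  refine isCompact_iUnion fun x => isCompact_iUnion fun y => IsCompact.image ?_ ?_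
  · refine (isCompact_sphere _ _).inter_right ?_
    refine isClosed_iInter fun z => isClosed_iInter fun _ => isClosed_iInter fun _ => ?_
    exact isClosed_eq (by fun_prop) continuous_const
  · refine continuous_matrix fun i j => ?_
    simp only [Matrix.vecMulVec_apply]
    fun_prop

theorem apply_vecMulVec_le_of_twoSupported {n : Type*} [Fintype n] (f : Matrix n n ℂ →ₗ[ℝ] ℝ) {u : ℝ}
    (hf : ∀ X ∈ twoSupportedProjectors n, f X ≤ u) {x y : n} (ψ : EuclideanSpace ℂ n)
    (hψ : ∀ z, z ≠ x → z ≠ y → ψ z = 0) :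
    f (Matrix.vecMulVec (fun z => ψ z) (fun z => star (ψ z))) ≤ u * ‖ψ‖ ^ 2 := by
  by_cases h0 : ψ = 0
  · subst h0
    have : Matrix.vecMulVec (fun z => (0 : EuclideanSpace ℂ n) z)
        (fun z => star ((0 : EuclideanSpace ℂ n) z)) = 0 := by
      ext i j; simp [Matrix.vecMulVec_apply]
    rw [this]; simp
  have hpos : 0 < ‖ψ‖ := norm_pos_iff.mpr h0
  have h := hf _ ⟨x, y, ((‖ψ‖⁻¹ : ℝ) : ℂ) • ψ, by
    rw [norm_smul]; simp [hpos.ne'], fun z h1 h2 => by simp [hψ z h1 h2], rfl⟩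
  have e : Matrix.vecMulVec (fun z => ψ z) (fun z => star (ψ z)) = (‖ψ‖ ^ 2 : ℝ) •
      Matrix.vecMulVec (fun z => (((‖ψ‖⁻¹ : ℝ) : ℂ) • ψ) z)
        (fun z => star ((((‖ψ‖⁻¹ : ℝ) : ℂ) • ψ) z)) := by
    ext i j
    have : (‖ψ‖ : ℂ) ≠ 0 := by exact_mod_cast hpos.ne'
    simp [Matrix.vecMulVec_apply]
    field_simp
  rw [e, map_smul, smul_eq_mul, mul_comm u]
  exact mul_le_mul_of_nonneg_left h (by positivity)

section Functional

variable {n : Type*} [Fintype n] [DecidableEq n]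

/-- Evaluate f on the projector of a e_x + b e_y and move the diagonal terms to the right. -/
theorem apply_single_add_single_le (f : Matrix n n ℂ →ₗ[ℝ] ℝ) {u : ℝ}
    (hf : ∀ X ∈ twoSupportedProjectors n, f X ≤ u) {x y : n} (hxy : x ≠ y) (a b : ℂ) :
    f (Matrix.single x y (a * star b) + Matrix.single y x (star (a * star b))) ≤
      ‖a‖ ^ 2 * (u - f (Matrix.single x x 1)) + ‖b‖ ^ 2 * (u - f (Matrix.single y y 1)) := by
  let ψ : EuclideanSpace ℂ n := EuclideanSpace.single x a + EuclideanSpace.single y b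
  have hnorm : ‖ψ‖ ^ 2 = ‖a‖ ^ 2 + ‖b‖ ^ 2 := by
    have horth : inner ℂ (EuclideanSpace.single x a) (EuclideanSpace.single y b) = (0 : ℂ) := by
      simp [EuclideanSpace.inner_single_left, hxy]
    have := norm_add_sq_eq_norm_sq_add_norm_sq_of_inner_eq_zero _ _ horth
    simp only [PiLp.norm_single] at this
    simp only [ψ, pow_two, this]
  have h := apply_vecMulVec_le_of_twoSupported f hf (x := x) (y := y) ψ
    (fun z h1 h2 => by simp [ψ, h1, h2])
  have e : Matrix.vecMulVec (fun z => ψ z) (fun z => star (ψ z)) =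
      (‖a‖ ^ 2 : ℝ) • Matrix.single x x (1 : ℂ) + (‖b‖ ^ 2 : ℝ) • Matrix.single y y (1 : ℂ) +
        (Matrix.single x y (a * star b) + Matrix.single y x (star (a * star b))) := by
    have ha : (‖a‖ : ℂ) ^ 2 = a * star a := by
      rw [Complex.star_def, Complex.mul_conj, Complex.normSq_eq_norm_sq]; push_cast; rfl
    have hb : (‖b‖ : ℂ) ^ 2 = b * star b := by
      rw [Complex.star_def, Complex.mul_conj, Complex.normSq_eq_norm_sq]; push_cast; rfl
    ext i j
    simp only [Matrix.vecMulVec_apply, Matrix.add_apply, Matrix.smul_apply, Complex.real_smul,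
      Complex.ofReal_pow, ha, hb, ψ, PiLp.add_apply, PiLp.single_apply,
      Matrix.single_apply]
    by_cases hix : i = x <;> by_cases hjx : j = x <;> by_cases hiy : i = y <;>
      by_cases hjy : j = y <;> simp_all [eq_comm, mul_comm]
  rw [e, map_add, map_add, map_smul, map_smul, hnorm, smul_eq_mul, smul_eq_mul] at h
  linarith

theorem apply_single_add_single_le_norm (f : Matrix n n ℂ →ₗ[ℝ] ℝ) {u : ℝ}
    (hf : ∀ X ∈ twoSupportedProjectors n, f X ≤ u)
    (hw : ∀ x, 0 < u - f (Matrix.single x x 1)) {x y : n} (hxy : x ≠ y) (z : ℂ) :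
    f (Matrix.single x y z + Matrix.single y x (star z)) ≤
      2 * ‖z‖ * (√(u - f (Matrix.single x x 1)) * √(u - f (Matrix.single y y 1))) := by
  by_cases hz : z = 0
  · simp [hz]
  set p := √(u - f (Matrix.single x x 1)) with hp
  set q := √(u - f (Matrix.single y y 1)) with hq
  have hp0 : 0 < p := Real.sqrt_pos.mpr (hw x)
  have hq0 : 0 < q := Real.sqrt_pos.mpr (hw y)
  have hz0 : 0 < ‖z‖ := norm_pos_iff.mpr hz
  -- This choice of a and b makes the two terms on the right equal, optimising the bound; a * star b
  -- is then a positive multiple of z.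
  have h := apply_single_add_single_le f hf hxy (z * q) ((‖z‖ * p : ℝ) : ℂ)
  have e : z * (q : ℂ) * star ((‖z‖ * p : ℝ) : ℂ) = (‖z‖ * p * q : ℝ) • z := by
    simp [Complex.real_smul]; ring
  have e2 : Matrix.single x y ((‖z‖ * p * q : ℝ) • z) +
      Matrix.single y x (star ((‖z‖ * p * q : ℝ) • z)) =
        (‖z‖ * p * q : ℝ) • (Matrix.single x y z + Matrix.single y x (star z)) := by
    rw [smul_add, Matrix.smul_single, Matrix.smul_single, star_smul, star_trivial]
  rw [e, e2, map_smul, smul_eq_mul, ← Real.sq_sqrt (hw x).le, ← Real.sq_sqrt (hw y).le,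
    ← hp, ← hq] at h
  have hn1 : ‖z * (q : ℂ)‖ = ‖z‖ * q := by simp [abs_of_pos hq0]
  have hn2 : ‖((‖z‖ * p : ℝ) : ℂ)‖ = ‖z‖ * p := by
    rw [Complex.norm_real, Real.norm_of_nonneg (by positivity)]
  rw [hn1, hn2] at h
  refine le_of_mul_le_mul_left (h.trans_eq ?_) (by positivity : 0 < ‖z‖ * p * q)
  ring

theorem apply_le_of_isHermitian_of_sum_norm_sq_le (hn : 1 < Fintype.card n)
    (f : Matrix n n ℂ →ₗ[ℝ] ℝ) {u : ℝ} (hf : ∀ X ∈ twoSupportedProjectors n, f X < u)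
    {ρ : Matrix n n ℂ} (hρ : ρ.IsHermitian) (htr : ρ.trace = 1)
    (hsq : ((Fintype.card n : ℝ) - 1) * ∑ x, ∑ y, ‖ρ x y‖ ^ 2 ≤ 1) : f ρ ≤ u := by
  -- Strictness of the separation is used here: positive weights permit the division in the
  -- off-diagonal bound.
  have hw : ∀ x, 0 < u - f (Matrix.single x x 1) := by
    intro x
    refine sub_pos.mpr (hf _ ⟨x, x, EuclideanSpace.single x 1, by simp,
      fun z h _ => by simp [h], ?_⟩)
    ext i j
    simp only [Matrix.vecMulVec_apply, PiLp.single_apply, Matrix.single_apply]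
    by_cases hi : i = x <;> by_cases hj : j = x <;> simp [hi, hj, Ne.symm]
  set s : n → ℝ := fun x => √(u - f (Matrix.single x x 1)) with hs
  have hs2 : ∀ x, s x * s x = u - f (Matrix.single x x 1) := fun x =>
    Real.mul_self_sqrt (hw x).le
  have hdiag : ∀ x, ((ρ x x).re : ℂ) = ρ x x := fun x => hρ.coe_re_apply_self x
  have htr' : ∑ x, (ρ x x).re = 1 := by
    have := congrArg Complex.re htr
    simpa [Matrix.trace] using this
  let M : n → n → ℝ := fun x y => if x = y then (ρ x x).re else -‖ρ x y‖
  have hMsq : ∀ x y, M x y ^ 2 = ‖ρ x y‖ ^ 2 := by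
    intro x y
    by_cases h : x = y
    · subst h
      rw [← hdiag x]
      simp [M]
    · simp [M, h]
  have hquad := sum_mul_mul_nonneg_of_sum_sq_le hn M (by simpa [M] using htr')
    (by simpa only [hMsq] using hsq) s
  -- Each entry is paired with its transpose, so summing over all (x, y) counts ρ twice; hence the
  -- factor 2.
  have hterm : ∀ x y, f (Matrix.single x y (ρ x y) + Matrix.single y x (ρ y x)) ≤
      2 * ((if x = y then (ρ x x).re * u else 0) - M x y * (s x * s y)) := by
    intro x y
    by_cases h : x = y
    · subst h
      have e : Matrix.single x x (ρ x x) = (ρ x x).re • Matrix.single x x (1 : ℂ) := by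
        rw [Matrix.smul_single, Complex.real_smul, hdiag, mul_one]
      simp only [M, if_true, hs2]
      rw [e, map_add, map_smul, smul_eq_mul]
      linarith
    · have := apply_single_add_single_le_norm f (fun X hX => (hf X hX).le) hw h (ρ x y)
      rw [hρ.apply y x] at this
      simp only [M, if_neg h]
      linarith
  have hdecomp : (2 : ℝ) • ρ =
      ∑ x, ∑ y, (Matrix.single x y (ρ x y) + Matrix.single y x (ρ y x)) := by
    simp only [Finset.sum_add_distrib]
    rw [Finset.sum_comm (f := fun x y => Matrix.single y x (ρ y x)),
      ← Matrix.matrix_eq_sum_single ρ, two_smul]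
  have h2 : 2 * f ρ ≤ ∑ x, ∑ y,
      2 * ((if x = y then (ρ x x).re * u else 0) - M x y * (s x * s y)) := by
    rw [← smul_eq_mul, ← map_smul, hdecomp]
    simp only [map_sum]
    exact Finset.sum_le_sum fun x _ => Finset.sum_le_sum fun y _ => hterm x y
  simp only [← Finset.mul_sum, Finset.sum_sub_distrib, Finset.sum_ite_eq, Finset.mem_univ,
    if_true, ← Finset.sum_mul, htr', one_mul] at h2
  linarith

theorem mem_convexHull_twoSupportedProjectors (hn : 1 < Fintype.card n)
    {ρ : Matrix n n ℂ} (hρ : ρ.IsHermitian) (htr : ρ.trace = 1)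
    (hsq : ((Fintype.card n : ℝ) - 1) * ∑ x, ∑ y, ‖ρ x y‖ ^ 2 ≤ 1) :
    ρ ∈ convexHull ℝ (twoSupportedProjectors n) := by
  by_contra hmem
  have : LocallyConvexSpace ℝ (Matrix n n ℂ) :=
    inferInstanceAs (LocallyConvexSpace ℝ (n → n → ℂ))
  obtain ⟨f, u, hf, hu⟩ := geometric_hahn_banach_closed_point (convex_convexHull ℝ _)
    (isCompact_twoSupportedProjectors n).convexHull_of_finiteDimensional.isClosed hmem
  exact hu.not_ge (apply_le_of_isHermitian_of_sum_norm_sq_le hn f.toLinearMap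
    (fun X hX => hf X (subset_convexHull ℝ _ hX)) hρ htr hsq)

theorem Matrix.IsHermitian.trace_sq_re {ρ : Matrix n n ℂ} (hρ : ρ.IsHermitian) :
    (ρ ^ 2).trace.re = ∑ x, ∑ y, ‖ρ x y‖ ^ 2 := by
  simp only [pow_two ρ, Matrix.trace, Matrix.diag_apply, Matrix.mul_apply, Complex.re_sum]
  refine Finset.sum_congr rfl fun x _ => Finset.sum_congr rfl fun y _ => ?_
  rw [← hρ.apply y x, Complex.star_def, Complex.mul_conj, Complex.normSq_eq_norm_sq,
    Complex.ofReal_re]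

end Functional

/-! ### Schmidt rank and Schmidt number -/

/-- The coefficient matrix has nonzero entries only in the rows `x.1` and `y.1`. -/
theorem schmidtRank_le_two_of_twoSupported {d : ℕ} {ψ : BipartiteVec d} {x y : Fin d × Fin d}
    (hψ : ∀ z, z ≠ x → z ≠ y → ψ z = 0) : schmidtRank ψ ≤ 2 := by
  refine (Matrix.rank_le_card_of_support_subset (coeffMatrix ψ) {x.1, y.1} ?_).trans
    Finset.card_le_two
  rw [Function.support_subset_iff']
  intro i hi
  simp only [Finset.coe_insert, Finset.coe_singleton, Set.mem_insert_iff,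
    Set.mem_singleton_iff, not_or] at hi
  ext j
  exact hψ (i, j) (fun h => hi.1 (by rw [← h])) (fun h => hi.2 (by rw [← h]))

theorem schmidtNumber_le_two_of_mem_convexHull {d : ℕ} {ρ : BipartiteOp d}
    (hρ : ρ ∈ convexHull ℝ (twoSupportedProjectors (Fin d × Fin d))) :
    schmidtNumber ρ ≤ 2 := by
  obtain ⟨ι, _, w, X, hw, hw1, hX, hsum⟩ := mem_convexHull_iff_exists_fintype.mp hρ
  choose x y ψ hnorm hsupp hXψ using hX
  let e := Fintype.equivFin ι
  let E : PureEnsemble d :=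
    { size := Fintype.card ι
      prob := fun k => w (e.symm k)
      vec := fun k => ψ (e.symm k)
      prob_nonneg := fun k => hw _
      sum_prob := (e.symm.sum_comp w).trans hw1
      norm_vec := fun k => hnorm _ }
  have hE : E.mixture = ρ := by
    rw [← hsum, ← e.symm.sum_comp]
    refine Finset.sum_congr rfl fun k _ => ?_
    rw [← hXψ]
    ext i j
    simp [E, Complex.real_smul]
  refine (iInf₂_le E hE).trans (iSup_le fun k => ?_)
  exact_mod_cast schmidtRank_le_two_of_twoSupported (hsupp (e.symm k))

theorem theorem4 (ρ : BipartiteOp 3) (hρ : ρ ∈ densityOperators 3)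
    (hpurity : (ρ ^ 2).trace.re ≤ 1 / 8) :
    ρ ∈ absoluteSchmidt 2 3 := by
  refine ⟨hρ, fun U hU => ?_⟩
  have hU' : star U * U = 1 := Matrix.mem_unitaryGroup_iff'.mp hU
  have hherm : (U * ρ * star U).IsHermitian :=
    Matrix.isHermitian_mul_mul_conjTranspose U hρ.1.isHermitian
  have htr : ∀ X : BipartiteOp 3, (U * X * star U).trace = X.trace := fun X => by
    rw [Matrix.trace_mul_comm, ← Matrix.mul_assoc, hU', Matrix.one_mul]
  have hsq : (U * ρ * star U) ^ 2 = U * ρ ^ 2 * star U := by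
    calc (U * ρ * star U) ^ 2 = U * ρ * (star U * U) * ρ * star U := by
          simp only [pow_two, Matrix.mul_assoc]
      _ = U * ρ ^ 2 * star U := by rw [hU']; simp only [pow_two, Matrix.mul_assoc, Matrix.one_mul]
  refine schmidtNumber_le_two_of_mem_convexHull
    (mem_convexHull_twoSupportedProjectors (by simp) hherm ((htr ρ).trans hρ.2) ?_)
  rw [← hherm.trace_sq_re, hsq, htr]
  simp only [Fintype.card_prod, Fintype.card_fin]
  norm_num at hpurity ⊢
  linarith
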